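/- Let $0\le J\le M$ and $L\ge 0$ be integers. Let $X_1,\dots,X_M$ (sources), $S$ (decoder side information) and $V$ (target variable) be random variables with finite alphabets $\mathcal X_1,\dots,\mathcal X_M,\mathcal S,\mathcal V$ and joint distribution $p(x_1,\dots,x_M,s,v)$. For $1\le l\le L$ let $d_l:\mathcal V\times\hat{\mathcal V}_l\to[0,d_{l,\max}]$ be a bounded distortion measure with reconstruction alphabet $\hat{\mathcal V}_l$. For a tuple $(Y_1,\dots,Y_M)$ and $I\subseteq\{1,\dots,M\}$ write $Y_I=(Y_i)_{i\in I}$ and $I^c=\{1,\dots,M\}\setminus I$. Mutual information is taken with the natural logarithm. Given finite alphabets $\mathcal Z_k$ and test channels $q_k(z_k|x_k)$, $J+1\le k\le M$, let $(X_{\{1,\dots,M\}},S,V,Z_{\{J+1,\dots,M\}})$ have the joint distribution $$p(x_1,\dots,x_M,s,v)\prod_{k=J+1}^M q_k(z_k|x_k),$$ and set $Z_m=X_m$ for $1\le m\le J$. Let $\mathcal A_1^*(\{q_k\})$ be the set of all $(R_1,\dots,R_M,D_1,\dots,D_L)\in\mathbb R^{M+L}$ such that 1. (rate conditions) $I(X_I;Z_I\mid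 Z_{I^c},S)\le\sum_{i\in I}R_i$ for every nonempty $I\subseteq\{1,\dots,M\}$; 2. (distortion conditions) for every $1\le l\le L$ there is a mapping $\psi_l:\mathcal X_1\times\dots\times\mathcal X_J\times\mathcal Z_{J+1}\times\dots\times\mathcal Z_M\times\mathcal S\to\hat{\mathcal V}_l$ with $\mathbb E\, d_l\bigl(V,\psi_l(X_{\{1,\dots,J\}},Z_{\{J+1,\dots,M\}},S)\bigr)\le D_l$. The canonical inner bound is the union $\mathcal A_1^*=\bigcup\mathcal A_1^*(\{q_k\})$ over all choices of finite alphabets $\mathcal Z_k$ and test channels $q_k$. Call a point of $\mathcal A_1^*$ (a set that need not be convex) extreme if it does not lie in the interior of a segment joining two distinct points of $\mathcal A_1^*$. Then every extreme point of $\mathcal A_1^*$ belongs to $\mathcal A_1^*(\{q_k\})$ for some choice of finite alphabets $\mathcal Z_k$ and test channels $q_k$ with $|\mathcal Z_k|\le|\mathcal X_k|$ for all $J+1\le k\le M$. -/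

import Mathlib

namespace MultiterminalSourceCoding

noncomputable section

/-! Probability and information quantities of random variables on a finite sample space `Ω`
carrying the probability mass function `P : Ω → ℝ`. Logarithms are natural. -/

section Information

variable {Ω α β γ : Type*} [Fintype Ω]

open Classical in
/-- The probability `P(U = u)`. -/
def probEq (P : Ω → ℝ) (U : Ω → α) (u : α) : ℝ :=
  ∑ ω with U ω = u, P ω

/-- The conditional entropy `H(U | W) = E[-log r(U | W)]`, where
`r(u | w) = P(U = u, W = w) / P(W = w)`. Sample points of probability zero contribute zero, and
at the others both probabilities in the quotient are positive. -/
def condEntropy (P : Ω → ℝ) (U : Ω → α) (W : Ω → γ) : ℝ :=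
  -∑ ω, P ω * Real.log (probEq P (fun ω' => (U ω', W ω')) (U ω, W ω) / probEq P W (W ω))

/-- The conditional mutual information `I(U; Y | W) = H(U | W) - H(U | Y, W)`. -/
def condMutualInfo (P : Ω → ℝ) (U : Ω → α) (Y : Ω → β) (W : Ω → γ) : ℝ :=
  condEntropy P U W - condEntropy P U (fun ω => (Y ω, W ω))

end Information

/-- The indices `1, …, J` of the sources with `Z_m = X_m` (counted from zero in `Fin M`). -/
abbrev Lossless (M J : ℕ) : Type := {m : Fin M // m.val < J}

/-- The indices `J + 1, …, M` of the sources with a genuine auxiliary variable `Z_k`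
(counted from zero in `Fin M`). -/
abbrev Lossy (M J : ℕ) : Type := {k : Fin M // J ≤ k.val}

section Region

variable {M J L : ℕ} {X : Fin M → Type*} {S V : Type*} {Vhat : Fin L → Type*}
  {Z : Lossy M J → Type*}

/-- The sample space of `(X_{1..M}, S, V, Z_{J+1..M})`. -/
abbrev Sample (X : Fin M → Type*) (S V : Type*) (Z : Lossy M J → Type*) : Type _ :=
  ((∀ m, X m) × S × V) × (∀ k, Z k)

/-- The tuple `X_I`. -/
def xVar (I : Finset (Fin M)) (ω : Sample X S V Z) : ∀ i : {i : Fin M // i ∈ I}, X i :=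
  fun i => ω.1.1 i

/-- The side information `S`. -/
def sVar (ω : Sample X S V Z) : S := ω.1.2.1

/-- The target variable `V`. -/
def vVar (ω : Sample X S V Z) : V := ω.1.2.2

/-- The tuple `Z_I`, where `Z_m = X_m` for the indices `m ∈ I` with `m ≤ J`. -/
def zVar (I : Finset (Fin M)) (ω : Sample X S V Z) :
    (∀ m : {m : Lossless M J // m.1 ∈ I}, X m.1.1) ×
      (∀ k : {k : Lossy M J // k.1 ∈ I}, Z k.1) :=
  (fun m => ω.1.1 m.1.1, fun k => ω.2 k.1)

/-- The joint distribution `p(x_{1..M}, s, v) ∏_{k = J+1}^M q_k(z_k | x_k)`. -/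
def jointLaw (p : (∀ m, X m) × S × V → ℝ) (q : ∀ k : Lossy M J, X k.1 → Z k → ℝ)
    (ω : Sample X S V Z) : ℝ :=
  p ω.1 * ∏ k : Lossy M J, q k (ω.1.1 k.1) (ω.2 k)

/-- Each `q_k(· | x)` is a probability vector on the alphabet of `Z_k`. -/
def IsTestChannels [∀ k, Fintype (Z k)] (q : ∀ k : Lossy M J, X k.1 → Z k → ℝ) : Prop :=
  ∀ k x, q k x ∈ stdSimplex ℝ (Z k)

variable [∀ m, Fintype (X m)] [Fintype S] [Fintype V] [∀ k, Fintype (Z k)]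

/-- The rate conditions `I(X_I; Z_I | Z_{I^c}, S) ≤ ∑_{i ∈ I} R_i` for all nonempty `I`. -/
def RateConditions (p : (∀ m, X m) × S × V → ℝ) (q : ∀ k : Lossy M J, X k.1 → Z k → ℝ)
    (R : Fin M → ℝ) : Prop :=
  ∀ I : Finset (Fin M), I.Nonempty →
    condMutualInfo (jointLaw p q) (xVar I) (zVar I) (fun ω => (zVar Iᶜ ω, sVar ω)) ≤ ∑ i ∈ I, R i

/-- The distortion conditions: for every `l` some mapping `ψ_l` satisfies
`E d_l(V, ψ_l(X_{1..J}, Z_{J+1..M}, S)) ≤ D_l`. -/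
def DistortionConditions (p : (∀ m, X m) × S × V → ℝ) (d : ∀ l, V → Vhat l → ℝ)
    (q : ∀ k : Lossy M J, X k.1 → Z k → ℝ) (D : Fin L → ℝ) : Prop :=
  ∀ l, ∃ ψ : (∀ m : Lossless M J, X m.1) → (∀ k : Lossy M J, Z k) → S → Vhat l,
    ∑ ω : Sample X S V Z,
      jointLaw p q ω * d l (vVar ω) (ψ (fun m => ω.1.1 m.1) ω.2 (sVar ω)) ≤ D l

/-- The part of the canonical inner bound that given test channels `q` generate. -/
def channelRegion (p : (∀ m, X m) × S × V → ℝ) (d : ∀ l, V → Vhat l → ℝ)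
    (q : ∀ k : Lossy M J, X k.1 → Z k → ℝ) : Set ((Fin M → ℝ) × (Fin L → ℝ)) :=
  {y | RateConditions p q y.1 ∧ DistortionConditions p d q y.2}

/-- The canonical inner bound: the pairs `(R, D)` that satisfy the rate and distortion conditions
for some finite alphabets of the auxiliary variables and some test channels. -/
def canonicalInnerBound (J : ℕ) (p : (∀ m, X m) × S × V → ℝ) (d : ∀ l, V → Vhat l → ℝ) :
    Set ((Fin M → ℝ) × (Fin L → ℝ)) :=
  {y | ∃ (Z : Lossy M J → Type) (_ : ∀ k, Fintype (Z k)) (q : ∀ k : Lossy M J, X k.1 → Z k → ℝ),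
    IsTestChannels q ∧ y ∈ channelRegion p d q}

end Region

end

end MultiterminalSourceCoding

/-!
Fix test channels that achieve an extreme point `(R, D)` and one index `k`. Replace
`q_k(z | x)` by `w z * q_k(z | x)`, where the weights `w ≥ 0` satisfy `∑ z, w z * q_k(z | x) = 1`
for every `x`. The joint law of all variables other than `Z_k` does not depend on `w`, and neither
does the conditional law of all variables given `Z_k`. Hence every rate
`F(I) = I(X_I; Z_I | Z_{I^c}, S)` and, for fixed reconstruction maps, every expected distortion is
affine in `w` (`exists_rate_reweight_eq`). The weights that achieve `(R, D)` therefore form a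
polytope, and it suffices to find a point of it with at most `|X_k|` nonzero weights.

Let `w` be an extreme point of the polytope. If more than `|X_k|` letters carry weight, there is
a direction `δ ≠ 0` supported on them with `∑ z, δ z * q_k(z | x) = 0` for all `x`, and `w ± t δ`
are admissible weights for small `t`. The point to settle is whether `(R, D)` can be moved along
with `w ± t δ`, although `2 ^ M - 1` rate conditions constrain only `M` rates. It can: by the
Markov property `F(I) = H(Z, S) - H(Z_{I^c}, S) - ∑_{i ∈ I} H(Z_i | X_i)` (`rate_eq`), so `F` is
supermodular (`rate_supermodular`), the sets `I` with `F(I) = R(I)` form a lattice, and the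
derivative of `F` along `δ` is modular on this lattice. A modular function on a lattice of sets
extends to an additive one (`exists_additive_extension`), which gives the direction `ρ` for the
rates. Then `(R, D)` is the midpoint of two points of the inner bound. As it is extreme, these
points coincide, so `w ± t δ` both achieve `(R, D)` and `w` is not an extreme point of the
polytope, a contradiction (`exists_weights_small_support`).

Treating the indices `k` one after the other (`exists_card_support_le`) and discarding the unused
letters (`mem_channelRegion_restrictChannels`) yields the cardinality bounds.
-/

namespace MultiterminalSourceCoding

/-! ### Entropy on a finite sample space -/

section Entropy

open Classical

variable {Ω Ω' α β γ α' γ' : Type*} [Fintype Ω] [Fintype Ω']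

/-- The Shannon entropy `H(U) = E[-log P(U)]`, as a sum over sample points. -/
noncomputable def entropy (P : Ω → ℝ) (U : Ω → α) : ℝ :=
  -∑ ω, P ω * Real.log (probEq P U (U ω))

lemma probEq_eq_sum_ite (P : Ω → ℝ) (U : Ω → α) (u : α) :
    probEq P U u = ∑ ω, if U ω = u then P ω else 0 := by
  unfold probEq
  rw [Finset.sum_filter]

lemma probEq_nonneg {P : Ω → ℝ} (hP : ∀ ω, 0 ≤ P ω) (U : Ω → α) (u : α) :
    0 ≤ probEq P U u :=
  Finset.sum_nonneg fun ω _ => hP ω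

lemma probEq_self_pos {P : Ω → ℝ} (hP : ∀ ω, 0 ≤ P ω) (U : Ω → α) {ω : Ω} (hω : P ω ≠ 0) :
    0 < probEq P U (U ω) := by
  have h : P ω ≤ probEq P U (U ω) :=
    Finset.single_le_sum (fun ω' _ => hP ω') (by simp)
  exact ((hP ω).lt_of_ne' hω).trans_le h

lemma probEq_congr (P : Ω → ℝ) {U : Ω → α} {U' : Ω → α'} {ω : Ω}
    (h : ∀ ω', U ω' = U ω ↔ U' ω' = U' ω) :
    probEq P U (U ω) = probEq P U' (U' ω) := by
  simp only [probEq_eq_sum_ite, h]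

lemma entropy_congr (P : Ω → ℝ) {U : Ω → α} {U' : Ω → α'}
    (h : ∀ ω ω', U ω = U ω' ↔ U' ω = U' ω') : entropy P U = entropy P U' := by
  unfold entropy
  congr 1
  exact Finset.sum_congr rfl fun ω _ => by rw [probEq_congr P fun ω' => h ω' ω]

lemma condEntropy_eq_entropy_sub {P : Ω → ℝ} (hP : ∀ ω, 0 ≤ P ω) (U : Ω → α) (W : Ω → γ) :
    condEntropy P U W = entropy P (fun ω => (U ω, W ω)) - entropy P W := by
  unfold condEntropy entropy
  rw [← neg_add', ← sub_eq_add_neg, ← Finset.sum_sub_distrib]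
  congr 1
  refine Finset.sum_congr rfl fun ω _ => ?_
  by_cases h : P ω = 0
  · simp [h]
  · rw [Real.log_div (probEq_self_pos hP (fun ω => (U ω, W ω)) h).ne' (probEq_self_pos hP W h).ne',
      mul_sub]

/-- The sum of the conditionally independent coupling of `U` and `W` given `C` over the pairs
`(U, W)` of positive probability does not exceed the total mass. -/
lemma sum_coupling_le {P : Ω → ℝ} (hP : ∀ ω, 0 ≤ P ω) {U : Ω → α} {W : Ω → β} {C : Ω → γ}
    (hU : ∀ ω ω', U ω = U ω' → C ω = C ω') (hW : ∀ ω ω', W ω = W ω' → C ω = C ω') :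
    ∑ ω, P ω * (probEq P U (U ω) * probEq P W (W ω) /
      (probEq P (fun ω => (U ω, W ω)) (U ω, W ω) * probEq P C (C ω))) ≤ ∑ ω, P ω := by
  -- Write `P(U)` and `P(W)` as sums over sample points `ω₁`, `ω₂` and sum over `ω` first.
  have h1 : ∀ ω, P ω * (probEq P U (U ω) * probEq P W (W ω) /
      (probEq P (fun ω => (U ω, W ω)) (U ω, W ω) * probEq P C (C ω))) =
      ∑ ω₁, ∑ ω₂, P ω₁ * P ω₂ * (if U ω = U ω₁ ∧ W ω = W ω₂ then
        P ω / (probEq P (fun ω => (U ω, W ω)) (U ω₁, W ω₂) * probEq P C (C ω₁)) else 0) := by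
    intro ω
    rw [probEq_eq_sum_ite P U, probEq_eq_sum_ite P W, Finset.sum_mul_sum, Finset.sum_div,
      Finset.mul_sum]
    refine Finset.sum_congr rfl fun ω₁ _ => ?_
    rw [Finset.sum_div, Finset.mul_sum]
    refine Finset.sum_congr rfl fun ω₂ _ => ?_
    by_cases a : U ω₁ = U ω
    · by_cases b : W ω₂ = W ω
      · rw [if_pos a, if_pos b, if_pos ⟨a.symm, b.symm⟩, a, b, hU _ _ a]
        ring
      · rw [if_neg b, if_neg fun h : U ω = U ω₁ ∧ W ω = W ω₂ => b h.2.symm]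
        simp
    · rw [if_neg a, if_neg fun h : U ω = U ω₁ ∧ W ω = W ω₂ => a h.1.symm]
      simp
  simp_rw [h1]
  rw [Finset.sum_comm]
  refine Finset.sum_le_sum fun ω₁ _ => ?_
  rw [Finset.sum_comm]
  have h2 : ∀ ω₂, ∑ ω, P ω₁ * P ω₂ * (if U ω = U ω₁ ∧ W ω = W ω₂ then
      P ω / (probEq P (fun ω => (U ω, W ω)) (U ω₁, W ω₂) * probEq P C (C ω₁)) else 0) ≤
      P ω₁ * (if C ω₂ = C ω₁ then P ω₂ else 0) / probEq P C (C ω₁) := by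
    intro ω₂
    rw [← Finset.mul_sum]
    by_cases hc : C ω₂ = C ω₁
    · have h3 : ∑ ω, (if U ω = U ω₁ ∧ W ω = W ω₂ then
          P ω / (probEq P (fun ω => (U ω, W ω)) (U ω₁, W ω₂) * probEq P C (C ω₁)) else 0) =
          probEq P (fun ω => (U ω, W ω)) (U ω₁, W ω₂) /
            probEq P (fun ω => (U ω, W ω)) (U ω₁, W ω₂) / probEq P C (C ω₁) := by
        rw [div_div]
        conv_rhs => rw [probEq_eq_sum_ite, Finset.sum_div]
        refine Finset.sum_congr rfl fun ω _ => ?_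
        by_cases h : U ω = U ω₁ ∧ W ω = W ω₂
        · rw [if_pos h, if_pos (Prod.ext h.1 h.2), probEq_eq_sum_ite]
        · rw [if_neg h, if_neg fun e => h ⟨congrArg Prod.fst e, congrArg Prod.snd e⟩, zero_div]
      rw [h3, if_pos hc, mul_div_assoc (P ω₁), mul_assoc]
      refine mul_le_mul_of_nonneg_left ?_ (hP _)
      rw [div_eq_mul_inv (P ω₂)]
      refine mul_le_mul_of_nonneg_left ?_ (hP _)
      rw [← one_div]
      exact div_le_div_of_nonneg_right (div_self_le_one _) (probEq_nonneg hP _ _)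
    · rw [if_neg hc, Finset.sum_eq_zero]
      · simp
      · intro ω _
        rw [if_neg]
        rintro ⟨a, b⟩
        exact hc ((hW _ _ b).symm.trans (hU _ _ a))
  refine (Finset.sum_le_sum fun ω₂ _ => h2 ω₂).trans ?_
  rw [← Finset.sum_div, ← Finset.mul_sum, ← probEq_eq_sum_ite, mul_div_assoc]
  exact mul_le_of_le_one_right (hP _) (div_self_le_one _)

/-- Submodularity of entropy: `I(U; W | C) ≥ 0` when `C` is a function of `U` and of `W`. -/
lemma entropy_submodular {P : Ω → ℝ} (hP : ∀ ω, 0 ≤ P ω) {U : Ω → α} {W : Ω → β} {C : Ω → γ}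
    (hU : ∀ ω ω', U ω = U ω' → C ω = C ω') (hW : ∀ ω ω', W ω = W ω' → C ω = C ω') :
    entropy P (fun ω => (U ω, W ω)) + entropy P C ≤ entropy P U + entropy P W := by
  have key : ∀ ω, P ω * Real.log (probEq P U (U ω)) + P ω * Real.log (probEq P W (W ω)) -
      P ω * Real.log (probEq P (fun ω => (U ω, W ω)) (U ω, W ω)) -
      P ω * Real.log (probEq P C (C ω)) ≤
      P ω * (probEq P U (U ω) * probEq P W (W ω) /
      (probEq P (fun ω => (U ω, W ω)) (U ω, W ω) * probEq P C (C ω))) - P ω := by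
    intro ω
    by_cases h : P ω = 0
    · simp [h]
    · have a := probEq_self_pos hP U h
      have b := probEq_self_pos hP W h
      have c := probEq_self_pos hP (fun ω => (U ω, W ω)) h
      have e := probEq_self_pos hP C h
      have l := Real.log_le_sub_one_of_pos (div_pos (mul_pos a b) (mul_pos c e))
      rw [Real.log_div (mul_pos a b).ne' (mul_pos c e).ne', Real.log_mul a.ne' b.ne',
        Real.log_mul c.ne' e.ne'] at l
      have := mul_le_mul_of_nonneg_left l (hP ω)
      linarith
  have hs := Finset.sum_le_sum fun ω (_ : ω ∈ Finset.univ) => key ω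
  have hc := sum_coupling_le hP hU hW
  simp only [Finset.sum_sub_distrib, Finset.sum_add_distrib] at hs
  unfold entropy
  linarith

lemma probEq_comp_injective {P : Ω → ℝ} {e : Ω' → Ω} (he : Function.Injective e)
    (h0 : ∀ ω, ω ∉ Set.range e → P ω = 0) {U : Ω → α} {U' : Ω' → α'} {ω : Ω'}
    (hU : ∀ ω', U (e ω') = U (e ω) ↔ U' ω' = U' ω) :
    probEq (fun ω => P (e ω)) U' (U' ω) = probEq P U (U (e ω)) := by
  simp only [probEq_eq_sum_ite, ← hU]
  exact Fintype.sum_of_injective e he _ _ (fun ω h => by simp [h0 ω h]) fun _ => rfl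

/-- Conditional entropy is unchanged by restriction to a set of sample points that carries all
of the mass, and by an injective relabelling of the values. -/
lemma condEntropy_comp_injective {P : Ω → ℝ} {e : Ω' → Ω} (he : Function.Injective e)
    (h0 : ∀ ω, ω ∉ Set.range e → P ω = 0) {U : Ω → α} {W : Ω → γ} {U' : Ω' → α'} {W' : Ω' → γ'}
    (hU : ∀ ω ω', U (e ω) = U (e ω') ↔ U' ω = U' ω')
    (hW : ∀ ω ω', W (e ω) = W (e ω') ↔ W' ω = W' ω') :
    condEntropy (fun ω => P (e ω)) U' W' = condEntropy P U W := by
  unfold condEntropy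
  congr 1
  refine Fintype.sum_of_injective e he _ _ (fun ω h => by simp [h0 ω h]) fun ω => ?_
  rw [probEq_comp_injective he h0 fun ω' => hW ω' ω,
    probEq_comp_injective (U := fun ω => (U ω, W ω)) (U' := fun ω => (U' ω, W' ω)) he h0
      fun ω' => by simp only [Prod.mk.injEq, hU, hW]]

end Entropy

/-! ### Modular functions on a lattice of sets -/

/-- A function that is modular on a family of finite sets closed under unions and intersections
extends to an additive set function. -/
lemma exists_additive_extension {ι : Type*} [Fintype ι] [DecidableEq ι] (T : Finset ι → Prop)
    (h0 : T ∅) (hT : ∀ I K, T I → T K → T (I ∪ K) ∧ T (I ∩ K)) (φ : Finset ι → ℝ) (hφ0 : φ ∅ = 0)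
    (hφ : ∀ I K, T I → T K → φ (I ∪ K) + φ (I ∩ K) = φ I + φ K) :
    ∃ ρ : ι → ℝ, ∀ I, T I → ∑ i ∈ I, ρ i = φ I := by
  classical
  have key : ∀ G, T G → ∃ ρ : ι → ℝ, ∀ I, T I → I ⊆ G → ∑ i ∈ I, ρ i = φ I := by
    intro G
    induction G using Finset.strongInduction with
    | H G ih =>
      intro hG
      rcases G.eq_empty_or_nonempty with rfl | hne
      · refine ⟨0, fun I _ hI => ?_⟩
        rw [Finset.subset_empty.1 hI, hφ0, Finset.sum_empty]
      -- A maximal member `G'` strictly below `G`: members below `G` but not below `G'` contain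
      -- all of `G \ G'`, so one point of `G \ G'` can carry the increment `φ G - φ G'`.
      obtain ⟨G', hG', hmax⟩ := (Finset.univ.filter fun I => T I ∧ I ⊂ G).exists_max_image
        Finset.card ⟨∅, by simp [h0, Finset.empty_ssubset.2 hne]⟩
      simp only [Finset.mem_filter, Finset.mem_univ, true_and] at hG' hmax
      obtain ⟨ρ, hρ⟩ := ih G' hG'.2 hG'.1
      obtain ⟨g, hg, hg'⟩ := Finset.exists_of_ssubset hG'.2
      refine ⟨fun i => if i ∈ G' then ρ i else if i = g then φ G - φ G' else 0,
        fun I hI hIG => ?_⟩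
      have hin : ∑ i ∈ I ∩ G', (if i ∈ G' then ρ i else if i = g then φ G - φ G' else 0) =
          φ (I ∩ G') := by
        rw [← hρ _ (hT _ _ hI hG'.1).2 Finset.inter_subset_right]
        exact Finset.sum_congr rfl fun i hi => if_pos (Finset.mem_inter.1 hi).2
      have hout : ∑ i ∈ I \ G', (if i ∈ G' then ρ i else if i = g then φ G - φ G' else 0) =
          if g ∈ I then φ G - φ G' else 0 := by
        rw [Finset.sum_congr rfl fun i hi => if_neg (Finset.mem_sdiff.1 hi).2,
          Finset.sum_ite_eq']
        simp [hg']
      rw [← Finset.sum_inter_add_sum_sdiff I G', hin, hout]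
      have hU : I ∪ G' ⊆ G := Finset.union_subset hIG hG'.2.1
      by_cases hle : I ⊆ G'
      · rw [if_neg fun h => hg' (hle h), Finset.inter_eq_left.2 hle, add_zero]
      · have hEq : I ∪ G' = G := by
          by_contra hne'
          have h1 := hmax _ ⟨(hT _ _ hI hG'.1).1, hU.ssubset_of_ne hne'⟩
          exact hle (Finset.union_eq_right.1
            (Finset.eq_of_subset_of_card_le Finset.subset_union_right h1).symm)
        have hgI : g ∈ I := by
          rw [← hEq] at hg
          exact (Finset.mem_union.1 hg).resolve_right hg'
        have := hφ _ _ hI hG'.1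
        rw [hEq] at this
        rw [if_pos hgI]
        linarith
  obtain ⟨G, hG, hmax⟩ := (Finset.univ.filter T).exists_max_image Finset.card
    ⟨∅, by simp [h0]⟩
  simp only [Finset.mem_filter, Finset.mem_univ, true_and] at hG hmax
  obtain ⟨ρ, hρ⟩ := key G hG
  refine ⟨ρ, fun I hI => hρ I hI ?_⟩
  have := Finset.eq_of_subset_of_card_le Finset.subset_union_right (hmax _ (hT _ _ hI hG).1)
  exact Finset.union_eq_right.1 this.symm

/-! ### Reweighting one auxiliary alphabet -/

/-- The weights `w` on the alphabet `ζ` for which `w z * q x z` is again a test channel. -/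
def weightPolytope {ξ ζ : Type*} [Fintype ζ] (q : ξ → ζ → ℝ) : Set (ζ → ℝ) :=
  {w | (∀ z, 0 ≤ w z) ∧ ∀ x, ∑ z, w z * q x z = 1}

lemma exists_relation_of_card_lt {ξ ζ : Type*} [Fintype ξ] [Fintype ζ] (q : ξ → ζ → ℝ)
    (A : Finset ζ) (hA : Fintype.card ξ < A.card) :
    ∃ δ : ζ → ℝ, δ ≠ 0 ∧ (∀ z ∉ A, δ z = 0) ∧ ∀ x, ∑ z, δ z * q x z = 0 := by
  classical
  have hli : ¬ LinearIndependent ℝ (fun z : A => fun x => q x z) := by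
    intro h
    have := h.fintype_card_le_finrank
    simp at this
    omega
  obtain ⟨g, hg, z, hz⟩ := Fintype.not_linearIndependent_iff.1 hli
  refine ⟨fun z => if h : z ∈ A then g ⟨z, h⟩ else 0, ?_, fun z h => dif_neg h, fun x => ?_⟩
  · intro h
    have := congrFun h z.1
    simp at this
    exact hz this
  · have := congrFun hg x
    simp only [Finset.sum_apply, Pi.smul_apply, smul_eq_mul, Pi.zero_apply] at this
    refine Eq.trans ?_ this
    rw [← Finset.sum_subset (Finset.subset_univ A), ← Finset.sum_coe_sort A]
    · exact Finset.sum_congr rfl fun z _ => by simp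
    · intro z _ hz
      exact mul_eq_zero_of_left (dif_neg hz) _

/-- If rates `F I` that are supermodular in `I`, and distortions, are affine in the weights, and
`(R, D)` is not the midpoint of two other achievable points, then `(R, D)` is achieved by weights
supported on at most `card ξ` letters (letters that never occur are not counted). -/
lemma exists_weights_small_support {ι κ ξ ζ : Type*} [Fintype ι] [DecidableEq ι] [Fintype κ]
    [Fintype ξ] [Fintype ζ] (q : ξ → ζ → ℝ) (hq0 : ∀ x z, 0 ≤ q x z)
    (c : Finset ι → ℝ) (a : Finset ι → ζ → ℝ) (b : κ → ζ → ℝ)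
    (hempty : ∀ w ∈ weightPolytope q, c ∅ + ∑ z, w z * a ∅ z = 0)
    (hsuper : ∀ w ∈ weightPolytope q, ∀ I K,
      (c I + ∑ z, w z * a I z) + (c K + ∑ z, w z * a K z) ≤
      (c (I ∪ K) + ∑ z, w z * a (I ∪ K) z) + (c (I ∩ K) + ∑ z, w z * a (I ∩ K) z))
    (R : ι → ℝ) (D : κ → ℝ)
    (hext : ∀ w₁ ∈ weightPolytope q, ∀ w₂ ∈ weightPolytope q, ∀ (ρ : ι → ℝ) (ε : κ → ℝ),
      (∀ I, c I + ∑ z, w₁ z * a I z ≤ ∑ i ∈ I, (R i + ρ i)) →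
      (∀ l, ∑ z, w₁ z * b l z ≤ D l + ε l) →
      (∀ I, c I + ∑ z, w₂ z * a I z ≤ ∑ i ∈ I, (R i - ρ i)) →
      (∀ l, ∑ z, w₂ z * b l z ≤ D l - ε l) → ρ = 0 ∧ ε = 0)
    {w₀ : ζ → ℝ} (hw₀ : w₀ ∈ weightPolytope q)
    (hR : ∀ I, c I + ∑ z, w₀ z * a I z ≤ ∑ i ∈ I, R i)
    (hD : ∀ l, ∑ z, w₀ z * b l z ≤ D l) :
    ∃ w ∈ weightPolytope q, (∀ I, c I + ∑ z, w z * a I z ≤ ∑ i ∈ I, R i) ∧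
      (∀ l, ∑ z, w z * b l z ≤ D l) ∧
      (Finset.univ.filter fun z => ∃ x, w z * q x z ≠ 0).card ≤ Fintype.card ξ := by
  classical
  -- The weights of letters that never occur are otherwise unconstrained; pinning them to their
  -- values under `w₀` makes the set of achieving weights compact.
  set Λ : Set (ζ → ℝ) := {w | ((∀ z, 0 ≤ w z) ∧ ∀ x, ∑ z, w z * q x z = 1) ∧
    (∀ z, (∀ x, q x z = 0) → w z = w₀ z) ∧
    (∀ I, c I + ∑ z, w z * a I z ≤ ∑ i ∈ I, R i) ∧ ∀ l, ∑ z, w z * b l z ≤ D l} with hΛ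
  have hcompact : IsCompact Λ := by
    have hclosed : IsClosed Λ := by
      simp only [hΛ, Set.ofPred_and, Set.ofPred_forall]
      refine ((isClosed_iInter fun z => ?_).inter (isClosed_iInter fun x => ?_)).inter
        ((isClosed_iInter fun z => isClosed_iInter fun _ => ?_).inter
        ((isClosed_iInter fun I => ?_).inter (isClosed_iInter fun l => ?_)))
      · exact isClosed_le (by fun_prop) (by fun_prop)
      · exact isClosed_eq (by fun_prop) (by fun_prop)
      · exact isClosed_eq (by fun_prop) (by fun_prop)
      · exact isClosed_le (by fun_prop) (by fun_prop)
      · exact isClosed_le (by fun_prop) (by fun_prop)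
    -- If `q x z > 0`, then `w z * q x z ≤ 1` bounds `w z`; the terms with `q x z = 0` vanish.
    refine (isCompact_Icc (a := (0 : ζ → ℝ))
      (b := fun z => w₀ z + ∑ x, (q x z)⁻¹)).of_isClosed_subset hclosed fun w hw => ⟨hw.1.1, fun z => ?_⟩
    have hnn : ∀ x, 0 ≤ (q x z)⁻¹ := fun x => inv_nonneg.2 (hq0 x z)
    by_cases h : ∀ x, q x z = 0
    · rw [hw.2.1 z h]
      exact le_add_of_nonneg_right (Finset.sum_nonneg fun x _ => hnn x)
    · push Not at h
      obtain ⟨x, hx⟩ := h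
      refine le_trans ?_ ((Finset.single_le_sum (fun x _ => hnn x) (Finset.mem_univ x)).trans
        (le_add_of_nonneg_left (hw₀.1 z)))
      have h1 : w z * q x z ≤ 1 := by
        rw [← hw.1.2 x]
        exact Finset.single_le_sum (f := fun z => w z * q x z)
          (fun z _ => mul_nonneg (hw.1.1 z) (hq0 x z)) (Finset.mem_univ z)
      rw [← one_div, le_div_iff₀ ((hq0 x z).lt_of_ne' hx)]
      exact h1
  -- An extreme point of the weights that achieve `(R, D)`.
  obtain ⟨w, hw, hwext⟩ := hcompact.extremePoints_nonempty
    ⟨w₀, hw₀, fun _ _ => rfl, hR, hD⟩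
  refine ⟨w, hw.1, hw.2.2.1, hw.2.2.2, ?_⟩
  by_contra! hcard
  obtain ⟨δ, hδ0, hδA, hδq⟩ := exists_relation_of_card_lt q _ hcard
  have hδw : ∀ z, w z = 0 → δ z = 0 := fun z hz => hδA z (by simp [hz])
  have hδz : ∀ z, (∀ x, q x z = 0) → δ z = 0 := fun z hz => hδA z (by simp [hz])
  have hlin : ∀ (t : ℝ) (f : ζ → ℝ),
      ∑ z, (w + t • δ) z * f z = ∑ z, w z * f z + t * ∑ z, δ z * f z := by
    intro t f
    simp only [Pi.add_apply, Pi.smul_apply, smul_eq_mul, add_mul, Finset.sum_add_distrib,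
      Finset.mul_sum, mul_assoc]
  have hev : ∀ᶠ t in nhds (0 : ℝ), ∀ z, 0 ≤ (w + t • δ) z := by
    refine Filter.eventually_all.2 fun z => ?_
    rcases (hw.1.1 z).eq_or_lt' with h | h
    · exact Filter.Eventually.of_forall fun t => by simp [h, hδw z h]
    · have hc : ContinuousAt (fun t : ℝ => (w + t • δ) z) 0 := by
        simp only [Pi.add_apply, Pi.smul_apply]
        fun_prop
      filter_upwards [hc.eventually (lt_mem_nhds (a := 0) (by simpa using h))] with t ht
      exact ht.le
  have hpoly : ∀ s : ℝ, (∀ z, 0 ≤ (w + s • δ) z) → w + s • δ ∈ weightPolytope q := by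
    intro s hs
    refine ⟨hs, fun x => ?_⟩
    rw [hlin, hδq, hw.1.2]
    simp
  -- A symmetric pair of small steps along `δ`.
  have hstep : ∀ {Q : ℝ → Prop}, (∀ᶠ t in nhds (0 : ℝ), Q t) → ∃ t > 0, Q t ∧ Q (-t) := by
    intro Q hQ
    obtain ⟨r, hr, hball⟩ := Metric.eventually_nhds_iff.1 hQ
    obtain ⟨t, ht0, htr⟩ := exists_between hr
    exact ⟨t, ht0, hball (by simpa [abs_of_pos ht0] using htr),
      hball (by simpa [abs_of_pos ht0] using htr)⟩
  -- The tight sets form a lattice on which the derivative of the rates is modular.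
  have htightlat : ∀ I K, c I + ∑ z, w z * a I z = ∑ i ∈ I, R i →
      c K + ∑ z, w z * a K z = ∑ i ∈ K, R i →
      c (I ∪ K) + ∑ z, w z * a (I ∪ K) z = ∑ i ∈ I ∪ K, R i ∧
      c (I ∩ K) + ∑ z, w z * a (I ∩ K) z = ∑ i ∈ I ∩ K, R i := by
    intro I K hI hK
    have h1 := hsuper w hw.1 I K
    have h2 := hw.2.2.1 (I ∪ K)
    have h3 := hw.2.2.1 (I ∩ K)
    have h4 := Finset.sum_union_inter (s₁ := I) (s₂ := K) (f := R)
    constructor <;> linarith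
  obtain ⟨t, ht0, hpos, hneg⟩ := hstep hev
  have hzero : ∑ z, δ z * a ∅ z = 0 := by
    have h1 := hempty _ hw.1
    have h2 := hempty _ (hpoly t hpos)
    rw [hlin] at h2
    have h3 : t * ∑ z, δ z * a ∅ z = 0 := by linarith
    exact (mul_eq_zero.1 h3).resolve_left ht0.ne'
  obtain ⟨ρ, hρ⟩ := exists_additive_extension
    (fun I => c I + ∑ z, w z * a I z = ∑ i ∈ I, R i) (by simpa using hempty w hw.1) htightlat
    (fun I => ∑ z, δ z * a I z) hzero (by
      intro I K hI hK
      obtain ⟨hU, hN⟩ := htightlat I K hI hK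
      have h1 := hsuper _ (hpoly t hpos) I K
      have h2 := hsuper _ (hpoly (-t) hneg) I K
      simp only [hlin] at h1 h2
      have h4 := Finset.sum_union_inter (s₁ := I) (s₂ := K) (f := R)
      refine mul_left_cancel₀ ht0.ne' ?_
      linarith)
  clear hpos hneg ht0 t
  -- A common step for which the rate inequalities that are strict at `w` persist, both for `R`
  -- itself and for `R` moved along `ρ`.
  have hslack : ∀ᶠ t in nhds (0 : ℝ), ∀ I, c I + ∑ z, w z * a I z < ∑ i ∈ I, R i →
      c I + ∑ z, (w + t • δ) z * a I z < ∑ i ∈ I, R i ∧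
      c I + ∑ z, (w + t • δ) z * a I z < ∑ i ∈ I, (R i + t * ρ i) := by
    refine Filter.eventually_all.2 fun I => ?_
    by_cases h : c I + ∑ z, w z * a I z < ∑ i ∈ I, R i
    · have hc : ContinuousAt (fun t : ℝ => c I + ∑ z, (w + t • δ) z * a I z) 0 := by
        simp only [hlin]
        fun_prop
      have hc' : ContinuousAt (fun t : ℝ => ∑ i ∈ I, (R i + t * ρ i)) 0 := by fun_prop
      filter_upwards [hc.eventually_lt continuousAt_const (by simpa using h),
        hc.eventually_lt hc' (by simpa using h)] with t h1 h2 _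
      exact ⟨h1, h2⟩
    · exact Filter.Eventually.of_forall fun t h' => absurd h' h
  obtain ⟨t, ht0, ⟨hpos, hpos'⟩, hneg, hneg'⟩ := hstep (hev.and hslack)
  have htight : ∀ (s : ℝ) (I), c I + ∑ z, w z * a I z = ∑ i ∈ I, R i →
      c I + ∑ z, (w + s • δ) z * a I z = ∑ i ∈ I, (R i + s * ρ i) := by
    intro s I hI
    rw [hlin, ← hρ I hI, Finset.sum_add_distrib, ← Finset.mul_sum, ← hI]
    ring
  obtain ⟨hρ0, hε0⟩ := hext _ (hpoly t hpos) _ (hpoly (-t) hneg) (fun i => t * ρ i)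
    (fun l => t * ∑ z, δ z * b l z)
    (fun I => (hw.2.2.1 I).eq_or_lt.elim (fun h => (htight t I h).le) fun h => (hpos' I h).2.le)
    (fun l => by rw [hlin]; linarith [hw.2.2.2 l])
    (fun I => by
      simp only [sub_eq_add_neg, ← neg_mul]
      exact (hw.2.2.1 I).eq_or_lt.elim (fun h => (htight (-t) I h).le)
        fun h => (hneg' I h).2.le)
    (fun l => by rw [hlin]; linarith [hw.2.2.2 l])
  have hρ' : ∀ i, ρ i = 0 := fun i => (mul_eq_zero.1 (congrFun hρ0 i)).resolve_left ht0.ne'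
  have hε' : ∀ l, ∑ z, δ z * b l z = 0 :=
    fun l => (mul_eq_zero.1 (congrFun hε0 l)).resolve_left ht0.ne'
  -- Since `(R, D)` does not move, `w` is the midpoint of two other members of the polytope.
  have hmem : ∀ s : ℝ, (∀ z, 0 ≤ (w + s • δ) z) → (∀ I, c I + ∑ z, w z * a I z < ∑ i ∈ I, R i →
      c I + ∑ z, (w + s • δ) z * a I z < ∑ i ∈ I, R i ∧
      c I + ∑ z, (w + s • δ) z * a I z < ∑ i ∈ I, (R i + s * ρ i)) → w + s • δ ∈ Λ := by
    intro s h1 h2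
    refine ⟨hpoly s h1, fun z hz => ?_, fun I => ?_, fun l => ?_⟩
    · simp [hδz z hz, hw.2.1 z hz]
    · refine (hw.2.2.1 I).eq_or_lt.elim (fun h => ?_) fun h => (h2 I h).1.le
      simpa [hρ'] using (htight s I h).le
    · rw [hlin, hε', mul_zero, add_zero]
      exact hw.2.2.2 l
  have hfix := hwext (hmem t hpos hpos') (hmem (-t) hneg hneg')
    ⟨1 / 2, 1 / 2, by norm_num, by norm_num, by norm_num, by module⟩
  have : t • δ = 0 := by simpa using hfix
  exact hδ0 ((smul_eq_zero.1 this).resolve_left ht0.ne')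

/-! ### Marginalising and reweighting one auxiliary variable -/

section Reweight

variable {M J : ℕ} {X : Fin M → Type*} {S V : Type*} {Z : Lossy M J → Type*}

open Classical in
/-- The test channels with the `k`-th one replaced by `w z * q_k(z | x)`. -/
noncomputable def reweight (q : ∀ k : Lossy M J, X k.1 → Z k → ℝ) (k : Lossy M J) (w : Z k → ℝ) :
    ∀ k : Lossy M J, X k.1 → Z k → ℝ :=
  Function.update q k fun x z => w z * q k x z

lemma reweight_self (q : ∀ k : Lossy M J, X k.1 → Z k → ℝ) (k : Lossy M J) (w : Z k → ℝ) :
    reweight q k w k = fun x z => w z * q k x z :=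
  Function.update_self ..

lemma reweight_of_ne (q : ∀ k : Lossy M J, X k.1 → Z k → ℝ) {k j : Lossy M J} (w : Z k → ℝ)
    (h : j ≠ k) : reweight q k w j = q j :=
  Function.update_of_ne h ..

lemma reweight_one (q : ∀ k : Lossy M J, X k.1 → Z k → ℝ) (k : Lossy M J) :
    reweight q k 1 = q := by
  simp [reweight]

open Classical in
/-- The joint law without the factor of the `k`-th test channel. -/
noncomputable def jointLawErase (p : (∀ m, X m) × S × V → ℝ)
    (q : ∀ k : Lossy M J, X k.1 → Z k → ℝ) (k : Lossy M J) (ω : Sample X S V Z) : ℝ :=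
  p ω.1 * ∏ j ∈ Finset.univ.erase k, q j (ω.1.1 j) (ω.2 j)

lemma jointLaw_eq_jointLawErase_mul (p : (∀ m, X m) × S × V → ℝ)
    (q : ∀ k : Lossy M J, X k.1 → Z k → ℝ) (k : Lossy M J) (ω : Sample X S V Z) :
    jointLaw p q ω = jointLawErase p q k ω * q k (ω.1.1 k) (ω.2 k) := by
  classical
  unfold jointLaw jointLawErase
  rw [mul_assoc, Finset.prod_erase_mul _ _ (Finset.mem_univ k)]

open Classical in
lemma jointLawErase_update (p : (∀ m, X m) × S × V → ℝ) (q : ∀ k : Lossy M J, X k.1 → Z k → ℝ)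
    (k : Lossy M J) (ω : Sample X S V Z) (a : Z k) :
    jointLawErase p q k (ω.1, Function.update ω.2 k a) = jointLawErase p q k ω := by
  unfold jointLawErase
  congr 1
  refine Finset.prod_congr rfl fun j hj => ?_
  dsimp only
  rw [Function.update_of_ne (Finset.ne_of_mem_erase hj)]

lemma jointLaw_reweight (p : (∀ m, X m) × S × V → ℝ) (q : ∀ k : Lossy M J, X k.1 → Z k → ℝ)
    (k : Lossy M J) (w : Z k → ℝ) (ω : Sample X S V Z) :
    jointLaw p (reweight q k w) ω = w (ω.2 k) * jointLaw p q ω := by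
  classical
  rw [jointLaw_eq_jointLawErase_mul p q k, jointLaw_eq_jointLawErase_mul p _ k, reweight_self]
  have : jointLawErase p (reweight q k w) k ω = jointLawErase p q k ω := by
    unfold jointLawErase
    congr 1
    exact Finset.prod_congr rfl fun j hj => by
      rw [reweight_of_ne q w (Finset.ne_of_mem_erase hj)]
  rw [this]
  ring

lemma sum_pi_mul_congr {ι : Type*} [Fintype ι] [DecidableEq ι] {Y : ι → Type*}
    [∀ i, Fintype (Y i)] (k : ι) (g : (∀ i, Y i) → ℝ)
    (hg : ∀ y a, g (Function.update y k a) = g y) {c c' : Y k → ℝ}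
    (h : ∑ a, c a = ∑ a, c' a) : ∑ y, g y * c (y k) = ∑ y, g y * c' (y k) := by
  have key : ∀ c : Y k → ℝ, ∑ y, g y * c (y k) =
      ∑ r, ∑ a, g ((Equiv.piSplitAt k Y).symm (a, r)) * c a := by
    intro c
    rw [← Finset.sum_comm, ← Fintype.sum_prod_type',
      ← (Equiv.piSplitAt k Y).symm.sum_comp fun y => g y * c (y k)]
    refine Finset.sum_congr rfl fun ⟨a, r⟩ _ => ?_
    simp [Equiv.piSplitAt]
  rw [key, key]
  refine Finset.sum_congr rfl fun r _ => ?_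
  rcases isEmpty_or_nonempty (Y k) with hE | ⟨⟨a₀⟩⟩
  · simp
  · have hconst : ∀ a, g ((Equiv.piSplitAt k Y).symm (a, r)) =
        g ((Equiv.piSplitAt k Y).symm (a₀, r)) := by
      intro a
      rw [← hg ((Equiv.piSplitAt k Y).symm (a₀, r)) a]
      congr 1
      funext i
      by_cases hi : i = k
      · subst hi
        simp [Equiv.piSplitAt]
      · simp [Equiv.piSplitAt, hi]
    simp only [hconst, ← Finset.mul_sum, h]

variable [∀ k, Fintype (Z k)]

lemma jointLaw_nonneg {p : (∀ m, X m) × S × V → ℝ} (hp : ∀ u, 0 ≤ p u)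
    {q : ∀ k : Lossy M J, X k.1 → Z k → ℝ} (hq : IsTestChannels q) (ω : Sample X S V Z) :
    0 ≤ jointLaw p q ω :=
  mul_nonneg (hp _) (Finset.prod_nonneg fun k _ => (hq k _).1 _)

lemma isTestChannels_reweight {q : ∀ k : Lossy M J, X k.1 → Z k → ℝ} (hq : IsTestChannels q)
    {k : Lossy M J} {w : Z k → ℝ} (hw : w ∈ weightPolytope (q k)) :
    IsTestChannels (reweight q k w) := by
  intro j x
  by_cases h : j = k
  · subst h
    rw [reweight_self]
    exact ⟨fun z => mul_nonneg (hw.1 z) ((hq j x).1 z), hw.2 x⟩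
  · rw [reweight_of_ne q w h]
    exact hq j x

variable [∀ m, Fintype (X m)] [Fintype S] [Fintype V]

open Classical in
/-- Two kernels from `X_k` to `Z_k` of the same row sums give the same marginals of the variables
other than `Z_k`. -/
lemma sum_mul_kernel_congr (k : Lossy M J) (g : Sample X S V Z → ℝ)
    (hg : ∀ ω a, g (ω.1, Function.update ω.2 k a) = g ω) {c c' : X k.1 → Z k → ℝ}
    (h : ∀ x, ∑ z, c x z = ∑ z, c' x z) :
    ∑ ω, g ω * c (ω.1.1 k) (ω.2 k) = ∑ ω, g ω * c' (ω.1.1 k) (ω.2 k) := by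
  rw [Fintype.sum_prod_type (fun ω => g ω * c (ω.1.1 k) (ω.2 k)),
    Fintype.sum_prod_type (fun ω => g ω * c' (ω.1.1 k) (ω.2 k))]
  exact Finset.sum_congr rfl fun x _ =>
    sum_pi_mul_congr k (fun z => g (x, z)) (fun z a => hg (x, z) a) (h (x.1 k))

open Classical in
lemma sum_jointLaw_reweight_mul (p : (∀ m, X m) × S × V → ℝ)
    {q : ∀ k : Lossy M J, X k.1 → Z k → ℝ} (hq : IsTestChannels q) {k : Lossy M J} {w : Z k → ℝ}
    (hw : w ∈ weightPolytope (q k)) (f : Sample X S V Z → ℝ)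
    (hf : ∀ ω a, f (ω.1, Function.update ω.2 k a) = f ω) :
    ∑ ω, jointLaw p (reweight q k w) ω * f ω = ∑ ω, jointLaw p q ω * f ω := by
  have := sum_mul_kernel_congr k (fun ω => jointLawErase p q k ω * f ω)
    (fun ω a => by rw [jointLawErase_update, hf])
    (c := fun x z => w z * q k x z) (c' := q k) fun x => by rw [hw.2, (hq k x).2]
  refine Eq.trans (Finset.sum_congr rfl fun ω _ => ?_)
    (this.trans (Finset.sum_congr rfl fun ω _ => ?_))
  · rw [jointLaw_reweight, jointLaw_eq_jointLawErase_mul p q k]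
    ring
  · rw [jointLaw_eq_jointLawErase_mul p q k]
    ring

open Classical in
lemma probEq_reweight_of_invariant {α : Type*} (p : (∀ m, X m) × S × V → ℝ)
    {q : ∀ k : Lossy M J, X k.1 → Z k → ℝ} (hq : IsTestChannels q) {k : Lossy M J} {w : Z k → ℝ}
    (hw : w ∈ weightPolytope (q k)) (U : Sample X S V Z → α)
    (hU : ∀ ω a, U (ω.1, Function.update ω.2 k a) = U ω) (u : α) :
    probEq (jointLaw p (reweight q k w)) U u = probEq (jointLaw p q) U u := by
  have := sum_jointLaw_reweight_mul p hq hw (fun ω => if U ω = u then 1 else 0)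
    (fun ω a => by rw [hU])
  simpa only [probEq_eq_sum_ite, mul_ite, mul_one, mul_zero] using this

open Classical in
lemma condEntropy_reweight_of_invariant {α γ : Type*} (p : (∀ m, X m) × S × V → ℝ)
    {q : ∀ k : Lossy M J, X k.1 → Z k → ℝ} (hq : IsTestChannels q) {k : Lossy M J} {w : Z k → ℝ}
    (hw : w ∈ weightPolytope (q k)) (U : Sample X S V Z → α) (W : Sample X S V Z → γ)
    (hU : ∀ ω a, U (ω.1, Function.update ω.2 k a) = U ω)
    (hW : ∀ ω a, W (ω.1, Function.update ω.2 k a) = W ω) :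
    condEntropy (jointLaw p (reweight q k w)) U W = condEntropy (jointLaw p q) U W := by
  unfold condEntropy
  simp only [probEq_reweight_of_invariant p hq hw W hW,
    probEq_reweight_of_invariant p hq hw (fun ω => (U ω, W ω)) fun ω a => by rw [hU, hW]]
  rw [sum_jointLaw_reweight_mul p hq hw]
  intro ω a
  rw [hU, hW]

open Classical in
lemma probEq_reweight_of_determines {α : Type*} (p : (∀ m, X m) × S × V → ℝ)
    (q : ∀ k : Lossy M J, X k.1 → Z k → ℝ) (k : Lossy M J) (w : Z k → ℝ)
    (U : Sample X S V Z → α) (hU : ∀ ω ω', U ω = U ω' → ω.2 k = ω'.2 k) (ω : Sample X S V Z) :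
    probEq (jointLaw p (reweight q k w)) U (U ω) =
      w (ω.2 k) * probEq (jointLaw p q) U (U ω) := by
  unfold probEq
  rw [Finset.mul_sum]
  refine Finset.sum_congr rfl fun ω' h => ?_
  rw [jointLaw_reweight, hU _ _ (Finset.mem_filter.1 h).2]

/-- Given `Z_k`, reweighting leaves the conditional law unchanged, so the conditional entropy
is linear in the weights. -/
lemma condEntropy_reweight_of_determines {α γ : Type*} (p : (∀ m, X m) × S × V → ℝ)
    (q : ∀ k : Lossy M J, X k.1 → Z k → ℝ) (k : Lossy M J) (w : Z k → ℝ)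
    (U : Sample X S V Z → α) (W : Sample X S V Z → γ)
    (hW : ∀ ω ω', W ω = W ω' → ω.2 k = ω'.2 k) :
    condEntropy (jointLaw p (reweight q k w)) U W =
      ∑ ω, w (ω.2 k) * -(jointLaw p q ω *
        Real.log (probEq (jointLaw p q) (fun ω => (U ω, W ω)) (U ω, W ω) /
          probEq (jointLaw p q) W (W ω))) := by
  unfold condEntropy
  rw [← Finset.sum_neg_distrib]
  refine Finset.sum_congr rfl fun ω _ => ?_
  rw [probEq_reweight_of_determines p q k w W hW,
    probEq_reweight_of_determines p q k w (fun ω => (U ω, W ω))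
      (fun ω ω' h => hW _ _ (congrArg Prod.snd h)) ω, jointLaw_reweight]
  by_cases h : w (ω.2 k) = 0
  · simp [h]
  · rw [mul_div_mul_left _ _ h]
    ring

open Classical in
lemma sum_weight_mul (k : Lossy M J) (w : Z k → ℝ) (h : Sample X S V Z → ℝ) :
    ∑ ω, w (ω.2 k) * h ω = ∑ z, w z * ∑ ω with ω.2 k = z, h ω := by
  rw [← Finset.sum_fiberwise (s := Finset.univ) (g := fun ω : Sample X S V Z => ω.2 k)]
  refine Finset.sum_congr rfl fun z _ => ?_
  rw [Finset.mul_sum]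
  exact Finset.sum_congr rfl fun ω hω => by rw [(Finset.mem_filter.1 hω).2]

end Reweight

/-! ### The rate function: affine in the weights, supermodular in the set of sources -/

section Rate

variable {M J : ℕ} {X : Fin M → Type*} {S V : Type*} {Z : Lossy M J → Type*}

lemma zVar_eq_iff (I : Finset (Fin M)) (ω ω' : Sample X S V Z) :
    zVar I ω = zVar I ω' ↔ (∀ m ∈ I, m.val < J → ω.1.1 m = ω'.1.1 m) ∧
      ∀ k : Lossy M J, k.1 ∈ I → ω.2 k = ω'.2 k := by
  simp only [zVar, Prod.mk.injEq, funext_iff, Subtype.forall]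
  exact and_congr ⟨fun h m a b => h m b a, fun h m b a => h m a b⟩ Iff.rfl

lemma xVar_eq_iff (I : Finset (Fin M)) (ω ω' : Sample X S V Z) :
    xVar I ω = xVar I ω' ↔ ∀ m ∈ I, ω.1.1 m = ω'.1.1 m := by
  simp only [xVar, funext_iff, Subtype.forall]

/-- The variable `(X_B, Z_A, S)` for a set `A` of auxiliary variables. -/
def sourceAuxVar (B : Finset (Fin M)) (A : Finset (Lossy M J)) (ω : Sample X S V Z) :
    (∀ i : {i : Fin M // i ∈ B}, X i) × (∀ k : {k : Lossy M J // k ∈ A}, Z k) × S :=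
  (xVar B ω, fun k => ω.2 k, sVar ω)

lemma sourceAuxVar_eq_iff (B : Finset (Fin M)) (A : Finset (Lossy M J)) (ω ω' : Sample X S V Z) :
    sourceAuxVar B A ω = sourceAuxVar B A ω' ↔ (∀ m ∈ B, ω.1.1 m = ω'.1.1 m) ∧
      (∀ k ∈ A, ω.2 k = ω'.2 k) ∧ sVar ω = sVar ω' := by
  rw [sourceAuxVar, sourceAuxVar, Prod.mk.injEq, Prod.mk.injEq, xVar_eq_iff, funext_iff,
    Subtype.forall]

variable [∀ m, Fintype (X m)] [Fintype S] [Fintype V] [∀ k, Fintype (Z k)]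

/-- The rate `I(X_I; Z_I | Z_{I^c}, S)`. -/
noncomputable def rate (p : (∀ m, X m) × S × V → ℝ) (q : ∀ k : Lossy M J, X k.1 → Z k → ℝ)
    (I : Finset (Fin M)) : ℝ :=
  condMutualInfo (jointLaw p q) (xVar I) (zVar I) (fun ω => (zVar Iᶜ ω, sVar ω))

lemma exists_rate_reweight_eq (p : (∀ m, X m) × S × V → ℝ)
    {q : ∀ k : Lossy M J, X k.1 → Z k → ℝ} (hq : IsTestChannels q) (k : Lossy M J)
    (I : Finset (Fin M)) : ∃ (c : ℝ) (a : Z k → ℝ), ∀ w ∈ weightPolytope (q k),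
      rate p (reweight q k w) I = c + ∑ z, w z * a z := by
  classical
  have hlin : ∀ (U : Sample X S V Z → ∀ i : {i : Fin M // i ∈ I}, X i) {γ : Type _}
      (W : Sample X S V Z → γ) (_ : ∀ ω ω', W ω = W ω' → ω.2 k = ω'.2 k),
      ∃ a : Z k → ℝ, ∀ w, condEntropy (jointLaw p (reweight q k w)) U W = ∑ z, w z * a z :=
    fun U _ W hW => ⟨_, fun w => by
      rw [condEntropy_reweight_of_determines p q k w U W hW, sum_weight_mul]⟩
  obtain ⟨a₂, h₂⟩ := hlin (xVar I) (fun ω => (zVar I ω, zVar Iᶜ ω, sVar ω)) (by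
    intro ω ω' h
    simp only [Prod.mk.injEq, zVar_eq_iff] at h
    by_cases hk : k.1 ∈ I
    · exact h.1.2 k hk
    · exact h.2.1.2 k (by simpa using hk))
  by_cases hk : k.1 ∈ I
  · refine ⟨condEntropy (jointLaw p q) (xVar I) (fun ω => (zVar Iᶜ ω, sVar ω)), fun z => -a₂ z,
      fun w hw => ?_⟩
    unfold rate condMutualInfo
    rw [h₂, condEntropy_reweight_of_invariant p hq hw]
    · simp [sub_eq_add_neg]
    · intro ω a
      rfl
    · intro ω a
      refine Prod.ext ((zVar_eq_iff _ _ _).2 ⟨fun _ _ _ => rfl, fun j hj => ?_⟩) rfl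
      refine Function.update_of_ne ?_ _ _
      rintro rfl
      exact Finset.mem_compl.1 hj hk
  · obtain ⟨a₁, h₁⟩ := hlin (xVar I) (fun ω => (zVar Iᶜ ω, sVar ω)) (by
      intro ω ω' h
      simp only [Prod.mk.injEq, zVar_eq_iff] at h
      exact h.1.2 k (by simpa using hk))
    refine ⟨0, fun z => a₁ z - a₂ z, fun w _ => ?_⟩
    unfold rate condMutualInfo
    rw [h₁, h₂, zero_add, ← Finset.sum_sub_distrib]
    exact Finset.sum_congr rfl fun z _ => by ring

/-- The conditional entropy `H(Z_k | X_k)`, as the expectation of `-log q_k(Z_k | X_k)`. -/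
noncomputable def channelEntropy (p : (∀ m, X m) × S × V → ℝ)
    (q : ∀ k : Lossy M J, X k.1 → Z k → ℝ) (k : Lossy M J) : ℝ :=
  -∑ ω : Sample X S V Z, jointLaw p q ω * Real.log (q k (ω.1.1 k) (ω.2 k))

open Classical in
/-- The Markov property of `Z_k`: given `X_k` it is independent of all other variables. -/
lemma probEq_sourceAuxVar_insert (p : (∀ m, X m) × S × V → ℝ)
    {q : ∀ k : Lossy M J, X k.1 → Z k → ℝ} (hq : IsTestChannels q) {B : Finset (Fin M)}
    {A : Finset (Lossy M J)} {k : Lossy M J} (hB : k.1 ∈ B) (hA : k ∉ A) (ω : Sample X S V Z) :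
    probEq (jointLaw p q) (sourceAuxVar B (insert k A)) (sourceAuxVar B (insert k A) ω) =
      probEq (jointLaw p q) (sourceAuxVar B A) (sourceAuxVar B A ω) *
        q k (ω.1.1 k) (ω.2 k) := by
  have := sum_mul_kernel_congr k
    (fun ω' => if sourceAuxVar B A ω' = sourceAuxVar B A ω then jointLawErase p q k ω' else 0)
    (fun ω' a => by
      have h : sourceAuxVar B A (ω'.1, Function.update ω'.2 k a) = sourceAuxVar B A ω' := by
        refine (sourceAuxVar_eq_iff _ _ _ _).2 ⟨fun _ _ => rfl, fun j hj => ?_, rfl⟩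
        exact Function.update_of_ne (ne_of_mem_of_not_mem hj hA) _ _
      rw [h, jointLawErase_update])
    (c := fun x z => if z = ω.2 k then q k x z else 0)
    (c' := fun x z => q k x z * q k x (ω.2 k)) fun x => by
      rw [← Finset.sum_mul, (hq k x).2, Finset.sum_ite_eq']
      simp
  rw [probEq_eq_sum_ite, probEq_eq_sum_ite, Finset.sum_mul]
  refine Eq.trans (Finset.sum_congr rfl fun ω' _ => ?_)
    (this.trans (Finset.sum_congr rfl fun ω' _ => ?_))
  · by_cases h1 : sourceAuxVar B A ω' = sourceAuxVar B A ω
    · have h1' := (sourceAuxVar_eq_iff _ _ _ _).1 h1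
      by_cases h2 : ω'.2 k = ω.2 k
      · rw [if_pos h1, if_pos h2, if_pos, jointLaw_eq_jointLawErase_mul p q k]
        refine (sourceAuxVar_eq_iff _ _ _ _).2 ⟨h1'.1, fun j hj => ?_, h1'.2.2⟩
        rcases Finset.mem_insert.1 hj with rfl | hj
        · exact h2
        · exact h1'.2.1 j hj
      · rw [if_neg h2, mul_zero, if_neg]
        intro h
        exact h2 (((sourceAuxVar_eq_iff _ _ _ _).1 h).2.1 k (Finset.mem_insert_self _ _))
    · rw [if_neg h1, zero_mul, if_neg]
      intro h
      have h' := (sourceAuxVar_eq_iff _ _ _ _).1 h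
      exact h1 ((sourceAuxVar_eq_iff _ _ _ _).2
        ⟨h'.1, fun j hj => h'.2.1 j (Finset.mem_insert_of_mem hj), h'.2.2⟩)
  · by_cases h1 : sourceAuxVar B A ω' = sourceAuxVar B A ω
    · rw [if_pos h1, if_pos h1, jointLaw_eq_jointLawErase_mul p q k,
        ((sourceAuxVar_eq_iff _ _ _ _).1 h1).1 _ hB]
      ring
    · rw [if_neg h1, if_neg h1, zero_mul, zero_mul]

open Classical in
lemma entropy_sourceAuxVar_insert {p : (∀ m, X m) × S × V → ℝ} (hp : ∀ u, 0 ≤ p u)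
    {q : ∀ k : Lossy M J, X k.1 → Z k → ℝ} (hq : IsTestChannels q) {B : Finset (Fin M)}
    {A : Finset (Lossy M J)} {k : Lossy M J} (hB : k.1 ∈ B) (hA : k ∉ A) :
    entropy (jointLaw p q) (sourceAuxVar B (insert k A)) =
      entropy (jointLaw p q) (sourceAuxVar B A) + channelEntropy p q k := by
  unfold entropy channelEntropy
  rw [← neg_add, ← Finset.sum_add_distrib]
  congr 1
  refine Finset.sum_congr rfl fun ω _ => ?_
  by_cases h : jointLaw p q ω = 0
  · simp [h]
  · have h1 := probEq_self_pos (jointLaw_nonneg hp hq) (sourceAuxVar B A) h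
    have h2 : q k (ω.1.1 k) (ω.2 k) ≠ 0 := by
      rw [jointLaw_eq_jointLawErase_mul p q k] at h
      exact right_ne_zero_of_mul h
    rw [probEq_sourceAuxVar_insert p hq hB hA, Real.log_mul h1.ne' h2, mul_add]

open Classical in
lemma entropy_sourceAuxVar_union {p : (∀ m, X m) × S × V → ℝ} (hp : ∀ u, 0 ≤ p u)
    {q : ∀ k : Lossy M J, X k.1 → Z k → ℝ} (hq : IsTestChannels q) {B : Finset (Fin M)}
    {A D : Finset (Lossy M J)} (hB : ∀ k ∈ D, k.1 ∈ B) (hA : Disjoint D A) :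
    entropy (jointLaw p q) (sourceAuxVar B (D ∪ A)) =
      entropy (jointLaw p q) (sourceAuxVar B A) + ∑ k ∈ D, channelEntropy p q k := by
  induction D using Finset.induction_on with
  | empty => rw [Finset.empty_union, Finset.sum_empty, add_zero]
  | insert k D hk ih =>
    rw [Finset.disjoint_insert_left] at hA
    rw [Finset.insert_union,
      entropy_sourceAuxVar_insert hp hq (hB k (by simp)) (by simp [hk, hA.1]),
      ih (fun j hj => hB j (by simp [hj])) hA.2, Finset.sum_insert hk]
    ring

/-- By the Markov property, `I(X_I; Z_I | Z_{I^c}, S)` is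
`H(Z, S) - H(Z_{I^c}, S) - ∑_{k ∈ I} H(Z_k | X_k)`. -/
lemma rate_eq {p : (∀ m, X m) × S × V → ℝ} (hp : ∀ u, 0 ≤ p u)
    {q : ∀ k : Lossy M J, X k.1 → Z k → ℝ} (hq : IsTestChannels q) (I : Finset (Fin M)) :
    rate p q I = entropy (jointLaw p q) (fun ω => (zVar Finset.univ ω, sVar ω)) -
      entropy (jointLaw p q) (fun ω => (zVar Iᶜ ω, sVar ω)) -
      ∑ k : Lossy M J, if k.1 ∈ I then channelEntropy p q k else 0 := by
  classical
  have hP := jointLaw_nonneg hp hq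
  set B : Finset (Fin M) := Finset.univ.filter fun m => m ∈ I ∨ m.val < J with hB
  set A : Finset (Lossy M J) := Finset.univ.filter fun k => k.1 ∉ I with hA
  set D : Finset (Lossy M J) := Finset.univ.filter fun k => k.1 ∈ I with hD
  have h1 : entropy (jointLaw p q) (fun ω => (xVar I ω, zVar Iᶜ ω, sVar ω)) =
      entropy (jointLaw p q) (sourceAuxVar B A) := by
    refine entropy_congr _ fun ω ω' => ?_
    simp only [Prod.mk.injEq, xVar_eq_iff, zVar_eq_iff, sourceAuxVar_eq_iff, hB, hA,
      Finset.mem_filter, Finset.mem_univ, true_and, Finset.mem_compl]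
    constructor
    · rintro ⟨a, ⟨b, c⟩, d⟩
      exact ⟨fun m hm => (em (m ∈ I)).elim (a m) fun h => b m h (hm.resolve_left h), c, d⟩
    · rintro ⟨a, b, c⟩
      exact ⟨fun m hm => a m (.inl hm), ⟨fun m _ hm => a m (.inr hm), b⟩, c⟩
  have h2 : entropy (jointLaw p q) (fun ω => (xVar I ω, zVar I ω, zVar Iᶜ ω, sVar ω)) =
      entropy (jointLaw p q) (sourceAuxVar B (D ∪ A)) := by
    refine entropy_congr _ fun ω ω' => ?_
    simp only [Prod.mk.injEq, xVar_eq_iff, zVar_eq_iff, sourceAuxVar_eq_iff, hB, hA, hD,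
      Finset.mem_union, Finset.mem_filter, Finset.mem_univ, true_and, Finset.mem_compl]
    constructor
    · rintro ⟨a, ⟨-, e⟩, ⟨b, c⟩, d⟩
      exact ⟨fun m hm => (em (m ∈ I)).elim (a m) fun h => b m h (hm.resolve_left h),
        fun k hk => hk.elim (e k) (c k), d⟩
    · rintro ⟨a, b, c⟩
      exact ⟨fun m hm => a m (.inl hm), ⟨fun m _ hm => a m (.inr hm), fun k hk => b k (.inl hk)⟩,
        ⟨fun m _ hm => a m (.inr hm), fun k hk => b k (.inr hk)⟩, c⟩
  have h3 : entropy (jointLaw p q) (fun ω => (zVar I ω, zVar Iᶜ ω, sVar ω)) =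
      entropy (jointLaw p q) (fun ω => (zVar Finset.univ ω, sVar ω)) := by
    refine entropy_congr _ fun ω ω' => ?_
    simp only [Prod.mk.injEq, zVar_eq_iff, Finset.mem_univ, Finset.mem_compl]
    constructor
    · rintro ⟨⟨a, b⟩, ⟨a', b'⟩, d⟩
      exact ⟨⟨fun m _ => (em (m ∈ I)).elim (a m) (a' m),
        fun k _ => (em (k.1 ∈ I)).elim (b k) (b' k)⟩, d⟩
    · rintro ⟨⟨a, b⟩, d⟩
      exact ⟨⟨fun m _ => a m trivial, fun k _ => b k trivial⟩,
        ⟨fun m _ => a m trivial, fun k _ => b k trivial⟩, d⟩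
  have h4 := entropy_sourceAuxVar_union hp hq (B := B) (A := A) (D := D)
    (fun k hk => by simpa [hB] using Or.inl (Finset.mem_filter.1 hk).2)
    (Finset.disjoint_filter_filter_not _ _ _)
  unfold rate condMutualInfo
  rw [condEntropy_eq_entropy_sub hP, condEntropy_eq_entropy_sub hP, h1, h2, h3, h4, hD,
    Finset.sum_filter]
  ring

lemma rate_empty {p : (∀ m, X m) × S × V → ℝ} (hp : ∀ u, 0 ≤ p u)
    {q : ∀ k : Lossy M J, X k.1 → Z k → ℝ} (hq : IsTestChannels q) : rate p q ∅ = 0 := by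
  rw [rate_eq hp hq, Finset.compl_empty]
  simp

lemma rate_supermodular {p : (∀ m, X m) × S × V → ℝ} (hp : ∀ u, 0 ≤ p u)
    {q : ∀ k : Lossy M J, X k.1 → Z k → ℝ} (hq : IsTestChannels q) (I K : Finset (Fin M)) :
    rate p q I + rate p q K ≤ rate p q (I ∪ K) + rate p q (I ∩ K) := by
  classical
  have h1 := entropy_submodular (jointLaw_nonneg hp hq)
    (U := fun ω => (zVar Iᶜ ω, sVar ω)) (W := fun ω => (zVar Kᶜ ω, sVar ω))
    (C := fun ω => (zVar (I ∪ K)ᶜ ω, sVar ω)) (by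
      intro ω ω' h
      simp only [Prod.mk.injEq, zVar_eq_iff, Finset.mem_compl, Finset.mem_union, not_or] at h ⊢
      exact ⟨⟨fun m hm => h.1.1 m hm.1, fun k hk => h.1.2 k hk.1⟩, h.2⟩) (by
      intro ω ω' h
      simp only [Prod.mk.injEq, zVar_eq_iff, Finset.mem_compl, Finset.mem_union, not_or] at h ⊢
      exact ⟨⟨fun m hm => h.1.1 m hm.2, fun k hk => h.1.2 k hk.2⟩, h.2⟩)
  have h2 : entropy (jointLaw p q) (fun ω => ((zVar Iᶜ ω, sVar ω), zVar Kᶜ ω, sVar ω)) =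
      entropy (jointLaw p q) (fun ω => (zVar (I ∩ K)ᶜ ω, sVar ω)) := by
    refine entropy_congr _ fun ω ω' => ?_
    simp only [Prod.mk.injEq, zVar_eq_iff, Finset.mem_compl, Finset.mem_inter]
    constructor
    · rintro ⟨⟨⟨a, b⟩, c⟩, ⟨a', b'⟩, -⟩
      exact ⟨⟨fun m hm => (not_and_or.1 hm).elim (a m) (a' m),
        fun k hk => (not_and_or.1 hk).elim (b k) (b' k)⟩, c⟩
    · rintro ⟨⟨a, b⟩, c⟩
      exact ⟨⟨⟨fun m hm => a m fun h => hm h.1, fun k hk => b k fun h => hk h.1⟩, c⟩,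
        ⟨fun m hm => a m fun h => hm h.2, fun k hk => b k fun h => hk h.2⟩, c⟩
  have h3 : (∑ k : Lossy M J, if k.1 ∈ I ∪ K then channelEntropy p q k else 0) +
      (∑ k : Lossy M J, if k.1 ∈ I ∩ K then channelEntropy p q k else 0) =
      (∑ k : Lossy M J, if k.1 ∈ I then channelEntropy p q k else 0) +
      ∑ k : Lossy M J, if k.1 ∈ K then channelEntropy p q k else 0 := by
    rw [← Finset.sum_add_distrib, ← Finset.sum_add_distrib]
    refine Finset.sum_congr rfl fun k _ => ?_
    by_cases a : k.1 ∈ I <;> by_cases b : k.1 ∈ K <;> simp [a, b]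
  rw [h2] at h1
  simp only [rate_eq hp hq]
  linarith

end Rate

/-! ### Reducing the alphabets -/

section Reduction

variable {M J L : ℕ} {X : Fin M → Type*} {S V : Type*} {Vhat : Fin L → Type*}

/-- The letters of the `k`-th auxiliary alphabet that the test channel uses. -/
def channelSupport {Z : Lossy M J → Type*} (q : ∀ k : Lossy M J, X k.1 → Z k → ℝ)
    (k : Lossy M J) : Set (Z k) :=
  {z | ∃ x, q k x z ≠ 0}

/-- Restriction of all test channels to the letters they use. -/
def restrictChannels {Z : Lossy M J → Type*} (q : ∀ k : Lossy M J, X k.1 → Z k → ℝ) :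
    ∀ k : Lossy M J, X k.1 → channelSupport q k → ℝ :=
  fun k x z => q k x z

/-- The inclusion of the sample space over the used letters. -/
def sampleInclusion {Z : Lossy M J → Type*} (q : ∀ k : Lossy M J, X k.1 → Z k → ℝ)
    (ω : Sample X S V fun k => channelSupport q k) : Sample X S V Z :=
  (ω.1, fun k => ω.2 k)

lemma sampleInclusion_injective {Z : Lossy M J → Type*}
    (q : ∀ k : Lossy M J, X k.1 → Z k → ℝ) :
    Function.Injective (sampleInclusion (S := S) (V := V) q) := by
  rintro ⟨u, z⟩ ⟨u', z'⟩ h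
  refine Prod.ext (congrArg Prod.fst h :) (funext fun k => Subtype.ext ?_)
  exact congrFun (congrArg Prod.snd h :) k

lemma jointLaw_eq_zero_of_notMem_range {Z : Lossy M J → Type*}
    (p : (∀ m, X m) × S × V → ℝ) (q : ∀ k : Lossy M J, X k.1 → Z k → ℝ) (ω : Sample X S V Z)
    (hω : ω ∉ Set.range (sampleInclusion (S := S) (V := V) q)) : jointLaw p q ω = 0 := by
  by_contra h
  refine hω ⟨(ω.1, fun k => ⟨ω.2 k, ω.1.1 k, fun h0 => h ?_⟩), rfl⟩
  unfold jointLaw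
  rw [Finset.prod_eq_zero (Finset.mem_univ k) h0, mul_zero]

lemma isTestChannels_restrictChannels {Z : Lossy M J → Type*} [∀ k, Fintype (Z k)]
    {q : ∀ k : Lossy M J, X k.1 → Z k → ℝ} [∀ k, Fintype (channelSupport q k)]
    (hq : IsTestChannels q) : IsTestChannels (restrictChannels q) := by
  intro k x
  refine ⟨fun z => (hq k x).1 z, ?_⟩
  rw [← (hq k x).2]
  refine Fintype.sum_of_injective _ Subtype.val_injective _ _ (fun z hz => ?_) fun _ => rfl
  by_contra h
  exact hz ⟨⟨z, x, h⟩, rfl⟩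

variable [∀ m, Fintype (X m)] [Fintype S] [Fintype V]

lemma rateConditions_iff {Z : Lossy M J → Type*} [∀ k, Fintype (Z k)]
    {p : (∀ m, X m) × S × V → ℝ} (hp : ∀ u, 0 ≤ p u) {q : ∀ k : Lossy M J, X k.1 → Z k → ℝ}
    (hq : IsTestChannels q) {R : Fin M → ℝ} :
    RateConditions p q R ↔ ∀ I, rate p q I ≤ ∑ i ∈ I, R i := by
  refine ⟨fun h I => ?_, fun h I _ => h I⟩
  rcases I.eq_empty_or_nonempty with rfl | hI
  · rw [rate_empty hp hq, Finset.sum_empty]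
  · exact h I hI

/-- One test channel of a configuration that achieves an extreme point can be reweighted so that
it uses at most as many letters as its input alphabet has. -/
lemma exists_reweight_card_support_le {Z : Lossy M J → Type} [∀ k, Fintype (Z k)]
    {p : (∀ m, X m) × S × V → ℝ} (hp : ∀ u, 0 ≤ p u) {d : ∀ l, V → Vhat l → ℝ}
    {y : (Fin M → ℝ) × (Fin L → ℝ)} (hy : y ∈ (canonicalInnerBound J p d).extremePoints ℝ)
    {q : ∀ k : Lossy M J, X k.1 → Z k → ℝ} (hq : IsTestChannels q)
    (hyq : y ∈ channelRegion p d q) (k : Lossy M J) :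
    ∃ w ∈ weightPolytope (q k), y ∈ channelRegion p d (reweight q k w) ∧
      (channelSupport (reweight q k w) k).ncard ≤ Fintype.card (X k.1) := by
  classical
  choose c a hca using fun I => exists_rate_reweight_eq p hq k I
  choose ψ hψ using hyq.2
  -- The expected distortions of the given reconstruction maps, as linear functions of the weights.
  set b : Fin L → Z k → ℝ := fun l z => ∑ ω : Sample X S V Z with ω.2 k = z,
    jointLaw p q ω * d l (vVar ω) (ψ l (fun m => ω.1.1 m.1) ω.2 (sVar ω)) with hb
  have hdist : ∀ (w : Z k → ℝ) l, ∑ ω : Sample X S V Z, jointLaw p (reweight q k w) ω *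
      d l (vVar ω) (ψ l (fun m => ω.1.1 m.1) ω.2 (sVar ω)) = ∑ z, w z * b l z := by
    intro w l
    rw [hb, ← sum_weight_mul]
    exact Finset.sum_congr rfl fun ω _ => by rw [jointLaw_reweight, mul_assoc]
  have hmem : ∀ w ∈ weightPolytope (q k), ∀ (R : Fin M → ℝ) (D : Fin L → ℝ),
      (∀ I, c I + ∑ z, w z * a I z ≤ ∑ i ∈ I, R i) → (∀ l, ∑ z, w z * b l z ≤ D l) →
      (R, D) ∈ channelRegion p d (reweight q k w) := by
    intro w hw R D hR hD
    refine ⟨fun I _ => ?_, fun l => ⟨ψ l, ?_⟩⟩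
    · exact (hca I w hw).trans_le (hR I)
    · rw [hdist]
      exact hD l
  have hone : (1 : Z k → ℝ) ∈ weightPolytope (q k) :=
    ⟨fun _ => zero_le_one, fun x => by simpa using (hq k x).2⟩
  obtain ⟨w, hw, hR, hD, hcard⟩ := exists_weights_small_support (q k) (fun x z => (hq k x).1 z)
    c a b
    (fun w hw => by rw [← hca _ w hw, rate_empty hp (isTestChannels_reweight hq hw)])
    (fun w hw I K => by
      simp only [← hca _ w hw]
      exact rate_supermodular hp (isTestChannels_reweight hq hw) I K)
    y.1 y.2
    (by
      intro w₁ hw₁ w₂ hw₂ ρ ε h1 h2 h3 h4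
      have m1 := hmem w₁ hw₁ (y.1 + ρ) (y.2 + ε) h1 h2
      have m2 := hmem w₂ hw₂ (y.1 - ρ) (y.2 - ε) h3 h4
      have h := hy.2 ⟨Z, _, _, isTestChannels_reweight hq hw₁, m1⟩
        ⟨Z, _, _, isTestChannels_reweight hq hw₂, m2⟩
        ⟨1 / 2, 1 / 2, by norm_num, by norm_num, by norm_num,
          Prod.ext (by simp only [Prod.fst_add, Prod.smul_fst]; module)
            (by simp only [Prod.snd_add, Prod.smul_snd]; module)⟩
      exact ⟨by simpa using congrArg Prod.fst h, by simpa using congrArg Prod.snd h⟩)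
    hone
    (fun I => by
      rw [← hca I 1 hone, reweight_one]
      exact (rateConditions_iff hp hq).1 hyq.1 I)
    (fun l => by
      rw [← hdist, reweight_one]
      exact hψ l)
  refine ⟨w, hw, hmem w hw _ _ hR hD, ?_⟩
  refine le_of_eq_of_le ?_ hcard
  rw [← Set.ncard_coe_finset]
  congr 1
  ext z
  simp [channelSupport, reweight_self]

lemma exists_card_support_le {Z : Lossy M J → Type} [∀ k, Fintype (Z k)]
    {p : (∀ m, X m) × S × V → ℝ} (hp : ∀ u, 0 ≤ p u) {d : ∀ l, V → Vhat l → ℝ}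
    {y : (Fin M → ℝ) × (Fin L → ℝ)} (hy : y ∈ (canonicalInnerBound J p d).extremePoints ℝ)
    {q : ∀ k : Lossy M J, X k.1 → Z k → ℝ} (hq : IsTestChannels q)
    (hyq : y ∈ channelRegion p d q) (T : Finset (Lossy M J)) :
    ∃ q' : ∀ k : Lossy M J, X k.1 → Z k → ℝ, IsTestChannels q' ∧ y ∈ channelRegion p d q' ∧
      ∀ k ∈ T, (channelSupport q' k).ncard ≤ Fintype.card (X k.1) := by
  classical
  induction T using Finset.induction_on with
  | empty => exact ⟨q, hq, hyq, by simp⟩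
  | insert k T hk ih =>
    obtain ⟨q', hq', hyq', hT⟩ := ih
    obtain ⟨w, hw, hyw, hcard⟩ := exists_reweight_card_support_le hp hy hq' hyq' k
    refine ⟨_, isTestChannels_reweight hq' hw, hyw, fun j hj => ?_⟩
    by_cases h : j = k
    · subst h
      exact hcard
    · have : channelSupport (reweight q' k w) j = channelSupport q' j := by
        unfold channelSupport
        rw [reweight_of_ne q' w h]
      rw [this]
      exact hT j ((Finset.mem_insert.1 hj).resolve_left h)

lemma mem_channelRegion_restrictChannels {Z : Lossy M J → Type*} [∀ k, Fintype (Z k)]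
    {p : (∀ m, X m) × S × V → ℝ} {d : ∀ l, V → Vhat l → ℝ} {y : (Fin M → ℝ) × (Fin L → ℝ)}
    {q : ∀ k : Lossy M J, X k.1 → Z k → ℝ} [∀ k, Fintype (channelSupport q k)]
    (hyq : y ∈ channelRegion p d q) : y ∈ channelRegion p d (restrictChannels q) := by
  have hinj := sampleInclusion_injective (S := S) (V := V) q
  have h0 := jointLaw_eq_zero_of_notMem_range p q
  have hz : ∀ (I : Finset (Fin M)) (ω ω' : Sample X S V fun k => channelSupport q k),
      zVar I (sampleInclusion q ω) = zVar I (sampleInclusion q ω') ↔ zVar I ω = zVar I ω' := by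
    intro I ω ω'
    rw [zVar_eq_iff, zVar_eq_iff]
    exact and_congr Iff.rfl (forall₂_congr fun k _ => Subtype.ext_iff.symm)
  refine ⟨fun I hI => le_of_eq_of_le ?_ (hyq.1 I hI), fun l => ?_⟩
  · unfold condMutualInfo
    congr 1
    · refine condEntropy_comp_injective hinj h0 (fun ω ω' => Iff.rfl) fun ω ω' => ?_
      simp only [Prod.mk.injEq, hz]
      exact Iff.rfl
    · refine condEntropy_comp_injective hinj h0 (fun ω ω' => Iff.rfl) fun ω ω' => ?_
      simp only [Prod.mk.injEq, hz]
      exact Iff.rfl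
  · obtain ⟨ψ, hψ⟩ := hyq.2 l
    refine ⟨fun x z s => ψ x (fun k => z k) s, le_of_eq_of_le ?_ hψ⟩
    exact Fintype.sum_of_injective _ hinj _ _ (fun ω h => by rw [h0 ω h, zero_mul]) fun _ => rfl

end Reduction

end MultiterminalSourceCoding

theorem mainTheorem1 {M J L : ℕ} (hJ : J ≤ M)
    {X : Fin M → Type*} [∀ m, Fintype (X m)]
    {S V : Type*} [Fintype S] [Fintype V] {Vhat : Fin L → Type*}
    (p : (∀ m, X m) × S × V → ℝ) (hp : p ∈ stdSimplex ℝ ((∀ m, X m) × S × V))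
    (d : ∀ l, V → Vhat l → ℝ) (dmax : Fin L → ℝ)
    (hd : ∀ l v w, d l v w ∈ Set.Icc 0 (dmax l))
    (y : (Fin M → ℝ) × (Fin L → ℝ))
    (hy : y ∈ (MultiterminalSourceCoding.canonicalInnerBound J p d).extremePoints ℝ) :
    ∃ (Z : MultiterminalSourceCoding.Lossy M J → Type) (_ : ∀ k, Fintype (Z k))
      (q : ∀ k : MultiterminalSourceCoding.Lossy M J, X k.1 → Z k → ℝ),
      (∀ k, Fintype.card (Z k) ≤ Fintype.card (X k.1)) ∧
      MultiterminalSourceCoding.IsTestChannels q ∧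
      y ∈ MultiterminalSourceCoding.channelRegion p d q := by
  obtain ⟨Z, _, q, hq, hyq⟩ := hy.1
  obtain ⟨q', hq', hyq', hcard⟩ :=
    MultiterminalSourceCoding.exists_card_support_le hp.1 hy hq hyq Finset.univ
  let inst : ∀ k, Fintype (MultiterminalSourceCoding.channelSupport q' k) :=
    fun k => Fintype.ofFinite _
  refine ⟨fun k => MultiterminalSourceCoding.channelSupport q' k, inst,
    MultiterminalSourceCoding.restrictChannels q', fun k => ?_,
    MultiterminalSourceCoding.isTestChannels_restrictChannels hq',
    MultiterminalSourceCoding.mem_channelRegion_restrictChannels hyq'⟩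
  rw [← Nat.card_eq_fintype_card]
  exact hcard k (Finset.mem_univ k)
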